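/- Let $\sigma,\lambda_0,\lambda_1,P>0$ and $r,\mu\in\mathbb R$, put $\tilde r:=r+\lambda_0$, and assume $\mu<\tilde r$. Let $h$ be a locally integrable real function on $[0,\infty)$ (the benefit schedule), let $H(t):=\int_0^t e^{-rs}h(s)\,ds$, and assume that $\beta:=\int_0^\infty \lambda_1e^{-\lambda_1t}H(t)\,dt$ converges absolutely. Put $\beta_1:=\beta\lambda_0/(\tilde r-\mu)$ and $g(x):=\beta_1x-P$. Let $(B_t)_{t\ge0}$ be a standard Brownian motion relative to a filtration $(\mathcal F_t)$ on a probability space (that is, adapted, with $B_t-B_s$ independent of $\mathcal F_s$ for $s\le t$), and for $x\ge0$ let $X_t=x\exp\{(\mu-\tfrac12\sigma^2)t+\sigma B_t\}$, with $\mathbb E_x$ denoting the expectation when $X$ starts from $x$. Define the value function $$v(x)=\sup_\tau\mathbb E_x\bigl[e^{-\tilde r\tau}g(X_\tau)\bigr]\in[-\infty,\infty],$$ where the supremum is over all $(\mathcal F_t)$-stopping times $\tau$ with values in $[0,\infty]$ and the random variable under the expectation is taken to be $0$ on $\{\tau=\infty\}$. Then: (i) $v(0)=0$, and $v(x)\ge0$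 for all $x\ge0$; (ii) $v(x)<\infty$ for all $x\ge0$. Moreover, for every $x\ge0$ the process $(e^{-\tilde rt}X_t)_{t\ge0}$ is a nonnegative supermartingale, and for every stopping time $\tau$ the variable $e^{-\tilde r\tau}X_\tau$ (taken to be $0$ on $\{\tau=\infty\}$) is integrable with $\mathbb E_x[e^{-\tilde r\tau}X_\tau]\le x$; in particular all the expectations in the definition of $v$ are well defined in $[-\infty,\infty)$. -/

import Mathlib

open MeasureTheory ProbabilityTheory
open scoped NNReal ENNReal

noncomputable section

namespace UnemploymentInsurance

/-- The numerical data of the unemployment insurance model. -/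
structure Params where
  /-- inflation rate `r` -/
  r : ℝ
  /-- drift `μ` of the wage process -/
  mu : ℝ
  /-- volatility `σ` of the wage process -/
  sigma : ℝ
  /-- loss-of-job rate `λ₀` -/
  lam0 : ℝ
  /-- rate `λ₁` of finding a new job -/
  lam1 : ℝ
  /-- one-off entry premium `P` -/
  premium : ℝ
  /-- benefit schedule `h(s)`, `s ≥ 0` -/
  h : ℝ → ℝ

namespace Params

/-- `H(t) = ∫₀ᵗ e^{-rs} h(s) ds`. -/
def bigH (p : Params) (t : ℝ) : ℝ :=
  ∫ s in (0 : ℝ)..t, Real.exp (-p.r * s) * p.h s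

/-- `β = ∫₀^∞ λ₁ e^{-λ₁ t} H(t) dt`. -/
def beta (p : Params) : ℝ :=
  ∫ t in Set.Ioi (0 : ℝ), p.lam1 * Real.exp (-p.lam1 * t) * p.bigH t

/-- `r̃ = r + λ₀`. -/
def rTilde (p : Params) : ℝ := p.r + p.lam0

/-- `β₁ = β λ₀ / (r̃ - μ)`. -/
def beta1 (p : Params) : ℝ := p.beta * p.lam0 / (p.rTilde - p.mu)

/-- The gain function `g(x) = β₁ x - P`. -/
def gain (p : Params) (x : ℝ) : ℝ := p.beta1 * x - p.premium

/-- The standing assumptions on the data: `σ, λ₀, λ₁, P > 0`, the integrals defining `H` and `β`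
converge, and `μ < r̃`. -/
structure Admissible (p : Params) : Prop where
  sigma_pos : 0 < p.sigma
  lam0_pos : 0 < p.lam0
  lam1_pos : 0 < p.lam1
  premium_pos : 0 < p.premium
  h_locallyIntegrable : LocallyIntegrableOn p.h (Set.Ici 0)
  beta_integrable : IntegrableOn
    (fun t : ℝ => p.lam1 * Real.exp (-p.lam1 * t) * p.bigH t) (Set.Ioi 0)
  mu_lt_rTilde : p.mu < p.rTilde

end Params

variable {Ω : Type*} {mΩ : MeasurableSpace Ω}

/-- `B` is a standard Brownian motion relative to the filtration `ℱ`: it is a Brownian motion,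
adapted to `ℱ`, and its increments after time `s` are independent of `ℱ s`. -/
structure IsBrownianMotionFor (B : ℝ≥0 → Ω → ℝ) (ℱ : Filtration ℝ≥0 mΩ) (Pr : Measure Ω) :
    Prop where
  isBrownian : IsBrownianReal B Pr
  adapted : Adapted ℱ B
  indep_increment : ∀ s t : ℝ≥0, s ≤ t →
    Indep (MeasurableSpace.comap (fun ω => B t ω - B s ω) inferInstance) (ℱ s) Pr

/-- The wage process started from `x`, i.e. the geometric Brownian motion
`X_t = x exp((μ - σ²/2) t + σ B_t)`. -/
def wage (p : Params) (B : ℝ≥0 → Ω → ℝ) (x : ℝ) (t : ℝ≥0) (ω : Ω) : ℝ :=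
  x * Real.exp ((p.mu - p.sigma ^ 2 / 2) * (t : ℝ) + p.sigma * B t ω)

/-- The discounted wage `e^{-r̃ t} X_t`. -/
def discountedWage (p : Params) (B : ℝ≥0 → Ω → ℝ) (x : ℝ) (t : ℝ≥0) (ω : Ω) : ℝ :=
  Real.exp (-p.rTilde * (t : ℝ)) * wage p B x t ω

/-- The discounted gain `e^{-r̃ t} g(X_t)`. -/
def discountedGain (p : Params) (B : ℝ≥0 → Ω → ℝ) (x : ℝ) (t : ℝ≥0) (ω : Ω) : ℝ :=
  Real.exp (-p.rTilde * (t : ℝ)) * p.gain (wage p B x t ω)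

/-- The value `Y_τ` of a process at a random time, set to zero on the event `{τ = ∞}`. -/
def valueAt (Y : ℝ≥0 → Ω → ℝ) (τ : Ω → WithTop ℝ≥0) : Ω → ℝ :=
  {ω | τ ω ≠ ⊤}.indicator (stoppedValue Y τ)

/-- The expectation `E[Z⁺] - E[Z⁻]`, with values in `[-∞, ∞]`; it is meaningful as soon as one of
the two terms is finite. -/
def expectation (Pr : Measure Ω) (Z : Ω → ℝ) : EReal :=
  ((∫⁻ ω, ENNReal.ofReal (Z ω) ∂Pr : ℝ≥0∞) : EReal) -
    ((∫⁻ ω, ENNReal.ofReal (-Z ω) ∂Pr : ℝ≥0∞) : EReal)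

/-- The value function `v(x) = sup_τ E_x[e^{-r̃ τ} g(X_τ)]`, the supremum being over all stopping
times `τ` of the filtration `ℱ` with values in `[0, ∞]`. -/
def valueFunction (p : Params) (B : ℝ≥0 → Ω → ℝ) (ℱ : Filtration ℝ≥0 mΩ) (Pr : Measure Ω)
    (x : ℝ) : EReal :=
  ⨆ (τ : Ω → WithTop ℝ≥0) (_ : IsStoppingTime ℱ τ),
    expectation Pr (valueAt (discountedGain p B x) τ)

end UnemploymentInsurance

end

open Filter Topology

namespace UnemploymentInsurance

/-! ### Optional stopping in continuous time by discretisation -/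

section OptionalStopping

variable {Ω : Type*} {mΩ : MeasurableSpace Ω} {Pr : Measure Ω}

/-! The discounted wage is an exponential of Brownian motion with drift whose conditional growth
rate is `μ - r̃ ≤ 0`, hence a nonnegative supermartingale. Optional stopping at an arbitrary `τ`
follows by approximating `τ` by bounded grid-valued times, applying the discrete theorem, and
passing to the limit with path continuity and Fatou (`optionalStopping_of_nonneg_supermartingale`).
Dropping the premium bounds the gain by `|β₁|` times the discounted wage, so `v(x) ≤ |β₁| x`; never
stopping gives `v ≥ 0`. Both bounds vanish at `x = 0`. -/

/-- Sampling of a filtration indexed by `ℝ≥0` along a monotone sequence of times. -/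
def sampledFiltration (ℱ : Filtration ℝ≥0 mΩ) (s : ℕ → ℝ≥0) (hs : Monotone s) :
    Filtration ℕ mΩ where
  seq j := ℱ (s j)
  mono' _ _ hij := ℱ.mono (hs hij)
  le' j := ℱ.le (s j)

/-- The mesh point `j / (k + 1)`. -/
noncomputable def gridPoint (k j : ℕ) : ℝ≥0 := (j : ℝ≥0) / ((k : ℝ≥0) + 1)

lemma gridPoint_mono (k : ℕ) : Monotone (gridPoint k) := fun i j hij => by
  unfold gridPoint
  gcongr

/-- The index of the first mesh point after `τ`, capped at `(k + 1) ^ 2`. -/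
noncomputable def gridIndex (τ : Ω → WithTop ℝ≥0) (k : ℕ) (ω : Ω) : WithTop ℕ :=
  min ((τ ω).map fun t => ⌈t * ((k : ℝ≥0) + 1)⌉₊) (((k + 1) ^ 2 : ℕ) : WithTop ℕ)

/-- Rounding up is what makes this work: `⌈t (k + 1)⌉ ≤ j` iff `t ≤ j / (k + 1)`, an event known at
the mesh point. -/
lemma gridIndex_isStoppingTime {ℱ : Filtration ℝ≥0 mΩ} {τ : Ω → WithTop ℝ≥0}
    (hτ : IsStoppingTime ℱ τ) (k : ℕ) :
    IsStoppingTime (sampledFiltration ℱ (gridPoint k) (gridPoint_mono k)) (gridIndex τ k) := by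
  refine IsStoppingTime.min_const (fun j => ?_) _
  have h : {ω | (τ ω).map (fun t => ⌈t * ((k : ℝ≥0) + 1)⌉₊) ≤ WithTop.some j}
      = {ω | τ ω ≤ (gridPoint k j : ℝ≥0)} := by
    ext ω
    by_cases hω : τ ω = ⊤
    · simp only [Set.mem_ofPred_eq, hω, WithTop.map_top, top_le_iff, WithTop.coe_ne_top]
    · obtain ⟨t, ht⟩ := WithTop.ne_top_iff_exists.1 hω
      have hk : (0 : ℝ≥0) < (k : ℝ≥0) + 1 := by positivity
      simp only [Set.mem_ofPred_eq, ← ht, WithTop.map_coe, WithTop.coe_le_coe, gridPoint]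
      rw [le_div_iff₀ hk, Nat.ceil_le]
  rw [h]
  exact hτ _

lemma gridIndex_le (τ : Ω → WithTop ℝ≥0) (k : ℕ) (ω : Ω) :
    gridIndex τ k ω ≤ (((k + 1) ^ 2 : ℕ) : WithTop ℕ) := min_le_right _ _

lemma tendsto_gridPoint_gridIndex {τ : Ω → WithTop ℝ≥0} {ω : Ω} {t : ℝ≥0} (hω : τ ω = t) :
    Tendsto (fun k => gridPoint k (gridIndex τ k ω).untopA) atTop (𝓝 t) := by
  have hlim : Tendsto (fun k : ℕ => (((k + 1 : ℕ) : ℝ))) atTop atTop :=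
    tendsto_natCast_atTop_atTop.comp (tendsto_add_atTop_nat 1)
  have h := (tendsto_nat_ceil_mul_div_atTop (R := ℝ) t.coe_nonneg).comp hlim
  rw [← NNReal.tendsto_coe]
  refine h.congr' ?_
  obtain ⟨n, hn⟩ := exists_nat_ge t
  filter_upwards [eventually_ge_atTop n] with k hk
  -- The cap corresponds to time `k + 1`, so it is inactive once `k ≥ t`.
  have hle : ⌈t * ((k : ℝ≥0) + 1)⌉₊ ≤ (k + 1) ^ 2 := by
    rw [Nat.ceil_le]
    have h1 : t ≤ (k : ℝ≥0) + 1 := hn.trans ((Nat.cast_le.2 hk).trans (by simp))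
    push_cast
    rw [sq]
    gcongr
  have hidx : gridIndex τ k ω = ((⌈t * ((k : ℝ≥0) + 1)⌉₊ : ℕ) : WithTop ℕ) := by
    rw [gridIndex, hω, WithTop.map_coe]
    exact min_eq_left (WithTop.coe_le_coe.2 hle)
  have hceil : ⌈(t : ℝ) * ((k + 1 : ℕ) : ℝ)⌉₊ = ⌈t * ((k : ℝ≥0) + 1)⌉₊ := by
    refine eq_of_forall_ge_iff fun n => ?_
    rw [Nat.ceil_le, Nat.ceil_le, ← NNReal.coe_le_coe]
    push_cast
    rfl
  rw [hidx]
  change _ = ((gridPoint k ⌈t * ((k : ℝ≥0) + 1)⌉₊ : ℝ≥0) : ℝ)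
  simp only [Function.comp_apply, gridPoint, hceil]
  push_cast
  rfl

variable [IsProbabilityMeasure Pr]

/-- Optional stopping for a discrete supermartingale at a bounded stopping time. -/
lemma integral_stoppedValue_le_of_supermartingale {𝒢 : Filtration ℕ mΩ} {Y : ℕ → Ω → ℝ}
    (hY : Supermartingale Y 𝒢 Pr) {ρ : Ω → WithTop ℕ} (hρ : IsStoppingTime 𝒢 ρ) {N : ℕ}
    (hN : ∀ ω, ρ ω ≤ N) : ∫ ω, stoppedValue Y ρ ω ∂Pr ≤ ∫ ω, Y 0 ω ∂Pr := by
  have h := hY.neg.expected_stoppedValue_mono (isStoppingTime_const 𝒢 0) hρ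
    (fun ω => zero_le) hN
  have e : stoppedValue (-Y) ρ = fun ω => -stoppedValue Y ρ ω := rfl
  have e0 : stoppedValue (-Y) (fun _ => WithTop.some 0) = fun ω => -Y 0 ω := rfl
  rw [e, e0, integral_neg, integral_neg] at h
  linarith

/-- Optional stopping for a nonnegative supermartingale with almost surely continuous paths at an
arbitrary stopping time. -/
theorem optionalStopping_of_nonneg_supermartingale {ℱ : Filtration ℝ≥0 mΩ} {Y : ℝ≥0 → Ω → ℝ}
    (hY : Supermartingale Y ℱ Pr) (hY0 : ∀ t ω, 0 ≤ Y t ω)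
    (hcont : ∀ᵐ ω ∂Pr, Continuous fun t => Y t ω)
    {τ : Ω → WithTop ℝ≥0} (hτ : IsStoppingTime ℱ τ) :
    Integrable (valueAt Y τ) Pr ∧ ∫ ω, valueAt Y τ ω ∂Pr ≤ ∫ ω, Y 0 ω ∂Pr := by
  set S : ℕ → Ω → ℝ := fun k =>
    stoppedValue (fun j => Y (gridPoint k j)) (gridIndex τ k) with hS
  -- On `{τ = ∞}` the capped samples need not tend to `0`, so they are cut off; by nonnegativity
  -- this only lowers the integral.
  set Z : ℕ → Ω → ℝ := fun k => {ω | τ ω ≠ ⊤}.indicator (S k) with hZ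
  have hsup : ∀ k, Supermartingale (fun j => Y (gridPoint k j))
      (sampledFiltration ℱ (gridPoint k) (gridPoint_mono k)) Pr := fun k =>
    ⟨fun j => hY.1 _, fun i j hij => hY.2.1 _ _ (gridPoint_mono k hij), fun j => hY.2.2 _⟩
  have hSint : ∀ k, Integrable (S k) Pr := fun k =>
    integrable_stoppedValue ℕ (gridIndex_isStoppingTime hτ k) (hsup k).2.2 (gridIndex_le τ k)
  have hfin : MeasurableSet {ω | τ ω ≠ ⊤} := hτ.measurableSet_eq_top.compl
  have hS0 : ∀ k ω, 0 ≤ S k ω := fun k ω => hY0 _ _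
  have hZ0 : ∀ k ω, 0 ≤ Z k ω := fun k ω => Set.indicator_nonneg (fun ω _ => hS0 k ω) ω
  have hZint : ∀ k, Integrable (Z k) Pr := fun k => (hSint k).indicator hfin
  have hgrid : ∀ k, gridPoint k 0 = 0 := fun k => by simp [gridPoint]
  have hZle : ∀ k, ∫ ω, Z k ω ∂Pr ≤ ∫ ω, Y 0 ω ∂Pr := fun k => by
    have h1 : ∫ ω, Z k ω ∂Pr ≤ ∫ ω, S k ω ∂Pr :=
      integral_mono (hZint k) (hSint k) (Set.indicator_le_self' fun ω _ => hS0 k ω)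
    have h2 := integral_stoppedValue_le_of_supermartingale (hsup k)
      (gridIndex_isStoppingTime hτ k) (gridIndex_le τ k)
    simp only [hgrid] at h2
    exact h1.trans h2
  have hlim : ∀ᵐ ω ∂Pr, Tendsto (fun k => Z k ω) atTop (𝓝 (valueAt Y τ ω)) := by
    filter_upwards [hcont] with ω hω
    by_cases h : τ ω = ⊤
    · simp [hZ, valueAt, h]
    · obtain ⟨t, ht⟩ := WithTop.ne_top_iff_exists.1 h
      have h1 : valueAt Y τ ω = Y t ω := by
        rw [valueAt, Set.indicator_of_mem (by exact h), stoppedValue, ← ht]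
        rfl
      have h2 : ∀ k, Z k ω = Y (gridPoint k (gridIndex τ k ω).untopA) ω := fun k => by
        simp [hZ, hS, stoppedValue, h]
      simp only [h1, h2]
      exact (hω.tendsto t).comp (tendsto_gridPoint_gridIndex ht.symm)
  have hmeas : AEStronglyMeasurable (valueAt Y τ) Pr :=
    aestronglyMeasurable_of_tendsto_ae atTop (fun k => (hZint k).1) hlim
  have hnn : ∀ ω, 0 ≤ valueAt Y τ ω := fun ω =>
    Set.indicator_nonneg (fun ω _ => hY0 _ _) ω
  -- Fatou's lemma; working with `∫⁻` gives integrability of the limit at the same time as the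
  -- bound.
  have hbound : ∫⁻ ω, ENNReal.ofReal (valueAt Y τ ω) ∂Pr ≤ ENNReal.ofReal (∫ ω, Y 0 ω ∂Pr) := by
    calc ∫⁻ ω, ENNReal.ofReal (valueAt Y τ ω) ∂Pr
        = ∫⁻ ω, liminf (fun k => ENNReal.ofReal (Z k ω)) atTop ∂Pr := by
          refine lintegral_congr_ae ?_
          filter_upwards [hlim] with ω hω
          exact ((ENNReal.continuous_ofReal.tendsto _).comp hω).liminf_eq.symm
      _ ≤ liminf (fun k => ∫⁻ ω, ENNReal.ofReal (Z k ω) ∂Pr) atTop :=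
          lintegral_liminf_le' fun k => (hZint k).1.aemeasurable.ennreal_ofReal
      _ ≤ ENNReal.ofReal (∫ ω, Y 0 ω ∂Pr) := by
          refine liminf_le_of_le (by isBoundedDefault) fun b hb => ?_
          obtain ⟨k, hk⟩ := hb.exists
          refine hk.trans ?_
          rw [← ofReal_integral_eq_lintegral_ofReal (hZint k) (ae_of_all _ (hZ0 k))]
          exact ENNReal.ofReal_le_ofReal (hZle k)
  have hint : Integrable (valueAt Y τ) Pr := by
    refine ⟨hmeas, ?_⟩
    rw [hasFiniteIntegral_iff_ofReal (ae_of_all _ hnn)]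
    exact hbound.trans_lt ENNReal.ofReal_lt_top
  refine ⟨hint, ?_⟩
  rw [← ofReal_integral_eq_lintegral_ofReal hint (ae_of_all _ hnn)] at hbound
  exact (ENNReal.ofReal_le_ofReal_iff (integral_nonneg fun ω => hY0 0 ω)).1 hbound

end OptionalStopping

/-! ### The discounted wage as a supermartingale -/

section DiscountedWage

variable {Ω : Type*} {mΩ : MeasurableSpace Ω} {Pr : Measure Ω} {ℱ : Filtration ℝ≥0 mΩ}
  {B : ℝ≥0 → Ω → ℝ}

lemma discountedWage_nonneg (p : Params) (B : ℝ≥0 → Ω → ℝ) {x : ℝ} (hx : 0 ≤ x) (t : ℝ≥0) (ω : Ω) :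
    0 ≤ discountedWage p B x t ω := by
  unfold discountedWage wage
  positivity

lemma discountedWage_eq (p : Params) (B : ℝ≥0 → Ω → ℝ) (x : ℝ) (t : ℝ≥0) (ω : Ω) :
    discountedWage p B x t ω =
      x * Real.exp ((p.mu - p.rTilde - p.sigma ^ 2 / 2) * (t : ℝ)) *
        Real.exp (p.sigma * B t ω) := by
  have h : Real.exp (-p.rTilde * (t : ℝ)) *
        Real.exp ((p.mu - p.sigma ^ 2 / 2) * (t : ℝ) + p.sigma * B t ω) =
      Real.exp ((p.mu - p.rTilde - p.sigma ^ 2 / 2) * (t : ℝ)) * Real.exp (p.sigma * B t ω) := by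
    rw [← Real.exp_add, ← Real.exp_add]
    ring_nf
  rw [discountedWage, wage, mul_left_comm, h, mul_assoc]

lemma integrable_exp_mul_of_hasLaw_gaussianReal {X : Ω → ℝ} {m : ℝ} {v : ℝ≥0}
    (hX : HasLaw X (gaussianReal m v) Pr) (c : ℝ) :
    Integrable (fun ω => Real.exp (c * X ω)) Pr := by
  have h := integrable_exp_mul_gaussianReal (μ := m) (v := v) c
  rw [← hX.map_eq] at h
  exact h.comp_aemeasurable hX.aemeasurable

lemma IsBrownianMotionFor.integrable_exp (hB : IsBrownianMotionFor B ℱ Pr) (c : ℝ) (t : ℝ≥0) :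
    Integrable (fun ω => Real.exp (c * B t ω)) Pr :=
  integrable_exp_mul_of_hasLaw_gaussianReal (hB.isBrownian.hasLaw_eval t) c

lemma IsBrownianMotionFor.integral_exp_increment (hB : IsBrownianMotionFor B ℱ Pr) (c : ℝ)
    {s t : ℝ≥0} (hst : s ≤ t) :
    ∫ ω, Real.exp (c * (B t ω - B s ω)) ∂Pr = Real.exp (c ^ 2 / 2 * ((t : ℝ) - s)) := by
  have h := mgf_gaussianReal (hB.isBrownian.hasLaw_sub t s).map_eq c
  have hd : ((nndist (t : ℝ) (s : ℝ) : ℝ≥0) : ℝ) = (t : ℝ) - s := by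
    rw [coe_nndist, Real.dist_eq, abs_of_nonneg (sub_nonneg.2 (NNReal.coe_le_coe.2 hst))]
  have e : ((nndist t.1 s.1 : ℝ≥0) : ℝ) = (t : ℝ) - s := hd
  rw [e] at h
  rw [show c ^ 2 / 2 * ((t : ℝ) - s) = 0 * c + ((t : ℝ) - s) * c ^ 2 / 2 by ring, ← h]
  rfl

/-- Split off the increment: the factor at time `s` is pulled out, and the independent increment
contributes its Gaussian moment generating function. -/
lemma IsBrownianMotionFor.condExp_exp [IsProbabilityMeasure Pr]
    (hB : IsBrownianMotionFor B ℱ Pr) (c : ℝ) {s t : ℝ≥0} (hst : s ≤ t) :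
    Pr[fun ω => Real.exp (c * B t ω) | ℱ s] =ᵐ[Pr]
      fun ω => Real.exp (c * B s ω) * Real.exp (c ^ 2 / 2 * ((t : ℝ) - s)) := by
  set f : Ω → ℝ := fun ω => Real.exp (c * B s ω) with hf
  set g : Ω → ℝ := fun ω => Real.exp (c * (B t ω - B s ω)) with hg
  have hfg : (fun ω => Real.exp (c * B t ω)) = f * g := by
    ext ω
    simp only [hf, hg, Pi.mul_apply, ← Real.exp_add]
    ring_nf
  have hfm : StronglyMeasurable[ℱ s] f :=
    (Real.measurable_exp.comp ((hB.adapted s).const_mul c)).stronglyMeasurable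
  have hgint : Integrable g Pr :=
    integrable_exp_mul_of_hasLaw_gaussianReal (hB.isBrownian.hasLaw_sub t s) c
  have hle : MeasurableSpace.comap (fun ω => B t ω - B s ω) inferInstance ≤ mΩ :=
    (((hB.adapted t).mono (ℱ.le t) le_rfl).sub ((hB.adapted s).mono (ℱ.le s) le_rfl)).comap_le
  have hgm : StronglyMeasurable[MeasurableSpace.comap (fun ω => B t ω - B s ω) inferInstance] g :=
    (Real.measurable_exp.comp
      ((comap_measurable (fun ω => B t ω - B s ω)).const_mul c)).stronglyMeasurable
  have h1 : Pr[f * g | ℱ s] =ᵐ[Pr] f * Pr[g | ℱ s] :=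
    condExp_mul_of_stronglyMeasurable_left hfm (hfg ▸ hB.integrable_exp c t) hgint
  have h2 : Pr[g | ℱ s] =ᵐ[Pr] fun _ => Pr[g] :=
    condExp_indep_eq hle (ℱ.le s) hgm (hB.indep_increment s t hst)
  rw [hfg]
  filter_upwards [h1, h2] with ω h1 h2
  rw [h1, Pi.mul_apply, h2, hB.integral_exp_increment c hst]

theorem supermartingale_discountedWage [IsProbabilityMeasure Pr]
    (hB : IsBrownianMotionFor B ℱ Pr) {p : Params} (hp : p.mu ≤ p.rTilde) {x : ℝ} (hx : 0 ≤ x) :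
    Supermartingale (discountedWage p B x) ℱ Pr := by
  have heq : ∀ t, discountedWage p B x t =
      (x * Real.exp ((p.mu - p.rTilde - p.sigma ^ 2 / 2) * (t : ℝ))) •
        fun ω => Real.exp (p.sigma * B t ω) := fun t => by
    ext ω
    exact discountedWage_eq p B x t ω
  refine ⟨fun t => ?_, fun s t hst => ?_, fun t => ?_⟩
  · rw [heq]
    exact ((Real.measurable_exp.comp ((hB.adapted t).const_mul p.sigma)).const_smul
      _).stronglyMeasurable
  · have h1 := condExp_smul (μ := Pr)
      (x * Real.exp ((p.mu - p.rTilde - p.sigma ^ 2 / 2) * (t : ℝ)))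
      (fun ω => Real.exp (p.sigma * B t ω)) (ℱ s)
    rw [heq t]
    filter_upwards [h1, hB.condExp_exp p.sigma hst] with ω h1 h2
    rw [h1, Pi.smul_apply, h2, discountedWage_eq, smul_eq_mul]
    have hst' : (s : ℝ) ≤ t := NNReal.coe_le_coe.2 hst
    have key : Real.exp ((p.mu - p.rTilde - p.sigma ^ 2 / 2) * (t : ℝ)) *
        Real.exp (p.sigma ^ 2 / 2 * ((t : ℝ) - s)) ≤
        Real.exp ((p.mu - p.rTilde - p.sigma ^ 2 / 2) * (s : ℝ)) := by
      rw [← Real.exp_add, Real.exp_le_exp]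
      -- The `σ² / 2` terms cancel, leaving `(μ - r̃) (t - s) ≤ 0`.
      nlinarith [mul_nonneg (sub_nonneg.2 hp) (sub_nonneg.2 hst')]
    calc _ = x * Real.exp (p.sigma * B s ω) *
          (Real.exp ((p.mu - p.rTilde - p.sigma ^ 2 / 2) * (t : ℝ)) *
            Real.exp (p.sigma ^ 2 / 2 * ((t : ℝ) - s))) := by ring
      _ ≤ x * Real.exp (p.sigma * B s ω) *
          Real.exp ((p.mu - p.rTilde - p.sigma ^ 2 / 2) * (s : ℝ)) := by gcongr
      _ = _ := by ring
  · rw [heq]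
    exact (hB.integrable_exp p.sigma t).smul _

lemma integral_discountedWage_zero [IsProbabilityMeasure Pr]
    (hB : IsBrownianMotionFor B ℱ Pr) (p : Params) (x : ℝ) :
    ∫ ω, discountedWage p B x 0 ω ∂Pr = x := by
  have h : discountedWage p B x 0 =ᵐ[Pr] fun _ => x := by
    filter_upwards [hB.isBrownian.eval_zero_ae_eq_zero] with ω hω
    simp [discountedWage_eq, hω]
  rw [integral_congr_ae h]
  simp

theorem discountedWage_optionalStopping [IsProbabilityMeasure Pr]
    (hB : IsBrownianMotionFor B ℱ Pr) {p : Params} (hp : p.mu ≤ p.rTilde) {x : ℝ} (hx : 0 ≤ x)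
    {τ : Ω → WithTop ℝ≥0} (hτ : IsStoppingTime ℱ τ) :
    Integrable (valueAt (discountedWage p B x) τ) Pr ∧
      ∫ ω, valueAt (discountedWage p B x) τ ω ∂Pr ≤ x := by
  have hcont : ∀ᵐ ω ∂Pr, Continuous fun t => discountedWage p B x t ω := by
    filter_upwards [hB.isBrownian.cont] with ω hω
    unfold discountedWage wage
    fun_prop
  have h := optionalStopping_of_nonneg_supermartingale (supermartingale_discountedWage hB hp hx)
    (discountedWage_nonneg p B hx) hcont hτ
  rwa [integral_discountedWage_zero hB p x] at h

end DiscountedWage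

/-! ### Bounds on the value function -/

section ValueFunction

variable {Ω : Type*} {mΩ : MeasurableSpace Ω} {Pr : Measure Ω} {ℱ : Filtration ℝ≥0 mΩ}
  {B : ℝ≥0 → Ω → ℝ}

/-- The stopping time `τ = ∞` has payoff zero. -/
lemma valueFunction_nonneg (p : Params) (B : ℝ≥0 → Ω → ℝ) (ℱ : Filtration ℝ≥0 mΩ)
    (Pr : Measure Ω) (x : ℝ) : 0 ≤ valueFunction p B ℱ Pr x := by
  have hτ : IsStoppingTime ℱ (fun _ : Ω => (⊤ : WithTop ℝ≥0)) := fun i => by simp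
  refine le_trans ?_ (le_iSup₂ (f := fun (τ : Ω → WithTop ℝ≥0) (_ : IsStoppingTime ℱ τ) =>
    expectation Pr (valueAt (discountedGain p B x) τ)) _ hτ)
  simp [expectation, valueAt]

/-- No integrability is needed: in `EReal`, `⊤ - ⊤ = ⊥`. This matters because the discounted premium
may have infinite mean when `r̃ < 0`. -/
lemma expectation_le_lintegral (Pr : Measure Ω) (Z : Ω → ℝ) :
    expectation Pr Z ≤ ((∫⁻ ω, ENNReal.ofReal (Z ω) ∂Pr : ℝ≥0∞) : EReal) := by
  rw [expectation, sub_eq_add_neg]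
  refine (add_le_add_right (EReal.neg_le_neg_iff.2 (EReal.coe_ennreal_nonneg _)) _).trans ?_
  simp

/-- The absolute value is there because the sign of `β₁` is not prescribed. -/
lemma valueAt_discountedGain_le {p : Params} (hP : 0 ≤ p.premium) (B : ℝ≥0 → Ω → ℝ) {x : ℝ}
    (hx : 0 ≤ x) (τ : Ω → WithTop ℝ≥0) (ω : Ω) :
    valueAt (discountedGain p B x) τ ω ≤ |p.beta1| * valueAt (discountedWage p B x) τ ω := by
  by_cases h : τ ω = ⊤
  · simp [valueAt, h]
  · simp only [valueAt, Set.indicator, Set.mem_ofPred_eq, h, ne_eq, not_false_eq_true, if_true,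
      stoppedValue]
    set t := (τ ω).untopA
    have h1 : discountedGain p B x t ω =
        p.beta1 * discountedWage p B x t ω - Real.exp (-p.rTilde * (t : ℝ)) * p.premium := by
      simp only [discountedGain, discountedWage, Params.gain]
      ring
    have h2 : 0 ≤ Real.exp (-p.rTilde * (t : ℝ)) * p.premium := by positivity
    have h3 := mul_le_mul_of_nonneg_right (le_abs_self p.beta1) (discountedWage_nonneg p B hx t ω)
    linarith

theorem valueFunction_le [IsProbabilityMeasure Pr] (hB : IsBrownianMotionFor B ℱ Pr) {p : Params}
    (hp : p.mu ≤ p.rTilde) (hP : 0 ≤ p.premium) {x : ℝ} (hx : 0 ≤ x) :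
    valueFunction p B ℱ Pr x ≤ ((ENNReal.ofReal (|p.beta1| * x) : ℝ≥0∞) : EReal) := by
  refine iSup₂_le fun τ hτ => (expectation_le_lintegral _ _).trans ?_
  obtain ⟨hint, hle⟩ := discountedWage_optionalStopping hB hp hx hτ
  refine EReal.coe_ennreal_le_coe_ennreal_iff.2 ?_
  calc ∫⁻ ω, ENNReal.ofReal (valueAt (discountedGain p B x) τ ω) ∂Pr
      ≤ ∫⁻ ω, ENNReal.ofReal (|p.beta1| * valueAt (discountedWage p B x) τ ω) ∂Pr :=
        lintegral_mono fun ω =>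
          ENNReal.ofReal_le_ofReal (valueAt_discountedGain_le hP B hx τ ω)
    _ = ENNReal.ofReal (∫ ω, |p.beta1| * valueAt (discountedWage p B x) τ ω ∂Pr) := by
        refine (ofReal_integral_eq_lintegral_ofReal (hint.const_mul _)
          (ae_of_all _ fun ω => ?_)).symm
        exact mul_nonneg (abs_nonneg _)
          (Set.indicator_nonneg (fun ω _ => discountedWage_nonneg p B hx _ ω) ω)
    _ ≤ ENNReal.ofReal (|p.beta1| * x) := by
        rw [integral_const_mul]
        gcongr

end ValueFunction

end UnemploymentInsurance

theorem mainTheorem3 {Ω : Type*} {mΩ : MeasurableSpace Ω}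
    (Pr : Measure Ω) [IsProbabilityMeasure Pr] (ℱ : Filtration ℝ≥0 mΩ)
    (B : ℝ≥0 → Ω → ℝ) (hB : UnemploymentInsurance.IsBrownianMotionFor B ℱ Pr)
    (p : UnemploymentInsurance.Params) (hp : p.Admissible) :
    UnemploymentInsurance.valueFunction p B ℱ Pr 0 = 0 ∧
    (∀ x : ℝ, 0 ≤ x → 0 ≤ UnemploymentInsurance.valueFunction p B ℱ Pr x) ∧
    (∀ x : ℝ, 0 ≤ x → UnemploymentInsurance.valueFunction p B ℱ Pr x < ⊤) ∧
    (∀ x : ℝ, 0 ≤ x →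
      (∀ t ω, 0 ≤ UnemploymentInsurance.discountedWage p B x t ω) ∧
      Supermartingale (UnemploymentInsurance.discountedWage p B x) ℱ Pr) ∧
    (∀ x : ℝ, 0 ≤ x → ∀ τ : Ω → WithTop ℝ≥0, IsStoppingTime ℱ τ →
      Integrable (UnemploymentInsurance.valueAt
        (UnemploymentInsurance.discountedWage p B x) τ) Pr ∧
      ∫ ω, UnemploymentInsurance.valueAt
        (UnemploymentInsurance.discountedWage p B x) τ ω ∂Pr ≤ x) := by
  have hmu := hp.mu_lt_rTilde.le
  have hP := hp.premium_pos.le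
  refine ⟨le_antisymm ?_ (UnemploymentInsurance.valueFunction_nonneg p B ℱ Pr 0),
    fun x _ => UnemploymentInsurance.valueFunction_nonneg p B ℱ Pr x, fun x hx => ?_,
    fun x hx => ⟨UnemploymentInsurance.discountedWage_nonneg p B hx,
      UnemploymentInsurance.supermartingale_discountedWage hB hmu hx⟩,
    fun x hx τ hτ => UnemploymentInsurance.discountedWage_optionalStopping hB hmu hx hτ⟩
  · simpa using UnemploymentInsurance.valueFunction_le hB hmu hP le_rfl
  · refine (UnemploymentInsurance.valueFunction_le hB hmu hP hx).trans_lt ?_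
    rw [lt_top_iff_ne_top]
    exact EReal.coe_ennreal_eq_top_iff.not.2 ENNReal.ofReal_ne_top
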